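/- Let $a,b\in\mathbb C$ be such that $U=\begin{bmatrix} a & b\\ -\bar b & \bar a\end{bmatrix}$ is unitary, i.e. $|a|^2+|b|^2=1$, and assume $a\neq 0$ (equivalently $|b|<1$). Let $C_1=\{-1,1\}$, write $|R\rangle=|1\rangle$ and $|L\rangle=|-1\rangle$ for the internal states, and let $U$ act on $\ell^2(C_1)$ in the ordered basis $(|R\rangle,|L\rangle)$, so that $U|R\rangle=a|R\rangle-\bar b|L\rangle$ and $U|L\rangle=b|R\rangle+\bar a|L\rangle$. Let $Q=T(I\otimes U)$ on $\ell^2(\mathbb Z\times C_1)$, where $T|g\rangle|\sigma\rangle=|g+\sigma\rangle|\sigma\rangle$. For an integer $n\ge 2$ let $\Pi$ be the orthogonal projection of $\ell^2(\mathbb Z\times C_1)$ onto the closed span of the basis states $|g\rangle|\sigma\rangle$ with $g\notin\{0,n\}$. For an integer $m$ with $1\le m\le n-1$ and $\alpha,\beta\in\mathbb C$, set $$P_n^{(m)}(\alpha,\beta)=\sum_{t=1}^\infty\ \sum_{\sigma\in\{R,L\}}\bigl|\langle 0,\sigma|\,Q(\Pi Q)^{t-1}\,|m\rangle(\alpha|R\rangle+\beta|L\rangle)\bigr|^2,$$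 which for $|\alpha|^2+|\beta|^2=1$ is the probability that the walk started in $|m\rangle(\alpha|R\rangle+\beta|L\rangle)$ and absorbed at $0$ and $n$ is eventually absorbed at $0$, and set $$H_n^{(m)}=\sum_{t=1}^\infty\langle 0,L|Q(\Pi Q)^{t-1}|m,R\rangle\,\overline{\langle 0,L|Q(\Pi Q)^{t-1}|m,L\rangle}.$$ For $k\ge 0$ put $R_k=(1+|b|)^k-(1-|b|)^k$ and $B_k=(1+|b|)^k+(1-|b|)^k$. Then the series defining $P_n^{(m)}(1,0)$, $P_n^{(m)}(0,1)$ and $H_n^{(m)}$ converge (the last one absolutely), and $$P_n^{(m)}(1,0)=\frac{|b|}{2}\cdot\frac{R_{n-m}B_{m-1}}{B_{n-1}},\qquad P_n^{(m)}(0,1)=\frac12\left(\frac{R_{n-m-1}R_m}{B_{n-1}}+|a|^2\,\frac{B_{n-m-1}B_{m-1}}{B_{n-1}}\right),$$ $$H_n^{(m)}=-\frac{a\bar b}{2}\cdot\frac{B_{n-m-1}B_{m-1}}{B_{n-1}}.$$ -/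

import Mathlib

namespace QuantumWalk

/-- The state space `ℓ²(G × S)` of a walk on the group `G` with direction set `S ⊆ G`.
The value `ψ (g, σ)` is the amplitude `⟨g, σ|ψ⟩`. -/
abbrev StateSpace {G : Type*} (S : Finset G) : Type _ := lp (fun _ : G × S => ℂ) 2

/-- The basis state `|g⟩|σ⟩`. -/
noncomputable def ket {G : Type*} [DecidableEq G] {S : Finset G} (x : G × S) : StateSpace S :=
  lp.single 2 x 1

theorem memℓp_coin {G : Type*} {S : Finset G} (U : Matrix S S ℂ) (ψ : StateSpace S) :
    Memℓp (fun x : G × S => ∑ τ : S, U x.2 τ * ψ (x.1, τ)) 2 := by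
  have key : ∀ τ : S, Memℓp (fun x : G × S => U x.2 τ * ψ (x.1, τ)) 2 := by
    intro τ
    have hψ : Summable fun x : G × S => ‖ψ x‖ ^ (2 : ENNReal).toReal :=
      (memℓp_gen_iff (by norm_num)).1 (lp.memℓp ψ)
    have h1 : Summable fun g : G => ‖ψ (g, τ)‖ ^ (2 : ENNReal).toReal :=
      hψ.comp_injective (i := fun g : G => (g, τ)) fun _ _ h => (Prod.mk.inj h).1
    have h2 : Summable fun σ : S => ‖U σ τ‖ ^ (2 : ENNReal).toReal := Summable.of_finite
    refine memℓp_gen ?_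
    refine (h1.mul_of_nonneg h2 (fun _ => by positivity) (fun _ => by positivity)).congr ?_
    intro x
    rw [norm_mul, Real.mul_rpow (norm_nonneg _) (norm_nonneg _), mul_comm]
  exact Memℓp.finsetSum Finset.univ fun τ _ => key τ

theorem memℓp_shift {G : Type*} [AddGroup G] {S : Finset G} (ψ : StateSpace S) :
    Memℓp (fun x : G × S => ψ (-(x.2 : G) + x.1, x.2)) 2 := by
  have hψ : Summable fun x : G × S => ‖ψ x‖ ^ (2 : ENNReal).toReal :=
    (memℓp_gen_iff (by norm_num)).1 (lp.memℓp ψ)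
  refine memℓp_gen ?_
  refine hψ.comp_injective (i := fun x : G × S => (-(x.2 : G) + x.1, x.2)) ?_
  rintro ⟨g, σ⟩ ⟨h, τ⟩ e
  obtain ⟨e1, e2⟩ := Prod.mk.inj e
  dsimp only at e1 e2
  subst e2
  rw [add_left_cancel e1]

open Classical in
theorem memℓp_no {G : Type*} {S : Finset G} (B : Set (G × S)) (ψ : StateSpace S) :
    Memℓp (fun x : G × S => if x ∈ B then 0 else ψ x) 2 := by
  have hψ : Summable fun x : G × S => ‖ψ x‖ ^ (2 : ENNReal).toReal :=
    (memℓp_gen_iff (by norm_num)).1 (lp.memℓp ψ)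
  refine memℓp_gen ?_
  refine hψ.of_nonneg_of_le (fun _ => by positivity) fun x => ?_
  split_ifs
  · simp
  · exact le_rfl

/-- The coin operator `I ⊗ U`, i.e. `|g⟩|τ⟩ ↦ ∑ σ, U σ τ |g⟩|σ⟩`. -/
noncomputable def coinOp {G : Type*} {S : Finset G} (U : Matrix S S ℂ) :
    StateSpace S →ₗ[ℂ] StateSpace S where
  toFun ψ := ⟨fun x => ∑ τ : S, U x.2 τ * ψ (x.1, τ), memℓp_coin U ψ⟩
  map_add' ψ φ := by
    ext x
    simp [mul_add, Finset.sum_add_distrib]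
    rfl
  map_smul' c ψ := by
    ext x
    simp [Finset.mul_sum, mul_left_comm]

/-- The translation operator `T`, i.e. `|g⟩|σ⟩ ↦ |σ + g⟩|σ⟩`. -/
noncomputable def shiftOp {G : Type*} [AddGroup G] (S : Finset G) :
    StateSpace S →ₗ[ℂ] StateSpace S where
  toFun ψ := ⟨fun x => ψ (-(x.2 : G) + x.1, x.2), memℓp_shift ψ⟩
  map_add' ψ φ := by
    ext x
    simp
    rfl
  map_smul' c ψ := by ext x; simp

/-- The walk operator `Q = T (I ⊗ U)` of the triple `(G, S, U)`. -/
noncomputable def walkOp {G : Type*} [AddGroup G] {S : Finset G} (U : Matrix S S ℂ) :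
    StateSpace S →ₗ[ℂ] StateSpace S :=
  shiftOp S ∘ₗ coinOp U

open Classical in
/-- The measurement projection `Π_no^B` onto the span of the basis states outside `B`. -/
noncomputable def noOp {G : Type*} {S : Finset G} (B : Set (G × S)) :
    StateSpace S →ₗ[ℂ] StateSpace S where
  toFun ψ := ⟨fun x => if x ∈ B then 0 else ψ x, memℓp_no B ψ⟩
  map_add' ψ φ := by
    ext x
    change (if x ∈ B then 0 else ψ x + φ x) = (if x ∈ B then 0 else ψ x) + if x ∈ B then 0 else φ x
    by_cases h : x ∈ B <;> simp [h]
  map_smul' c ψ := by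
    ext x
    by_cases h : x ∈ B <;> simp [h]

/-- The absorbing walk operator `Π_no^B Q` of the quadruple `(G, S, U, B)`. -/
noncomputable def absorbingWalkOp {G : Type*} [AddGroup G] {S : Finset G} (U : Matrix S S ℂ)
    (B : Set (G × S)) : StateSpace S →ₗ[ℂ] StateSpace S :=
  noOp B ∘ₗ walkOp U

/-- The amplitude `⟨x| Q (Π_no^B Q)^t |ψ⟩`, i.e. the amplitude with which the walk started in `ψ`
is found at `x` at time `t + 1`, without having been found in `B` before. -/
noncomputable def hitAmplitude {G : Type*} [AddGroup G] {S : Finset G} (U : Matrix S S ℂ)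
    (B : Set (G × S)) (ψ : StateSpace S) (x : G × S) (t : ℕ) : ℂ :=
  (walkOp U ((absorbingWalkOp U B ^ t) ψ)) x

/-- The probability that the walk started in `ψ` is absorbed in `B₀` at time `t + 1`. -/
noncomputable def absorptionTerm {G : Type*} [AddGroup G] {S : Finset G} (U : Matrix S S ℂ)
    (B : Set (G × S)) (B₀ : Finset (G × S)) (ψ : StateSpace S) (t : ℕ) : ℝ :=
  ∑ x ∈ B₀, ‖hitAmplitude U B ψ x t‖ ^ 2

/-- The direction set `C₁ = {-1, 1}` of the two-state walk on `ℤ`. -/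
abbrev C₁ : Finset ℤ := {-1, 1}

/-- The internal state `R`, a step to the right. -/
def dirR : C₁ := ⟨1, by decide⟩

/-- The internal state `L`, a step to the left. -/
def dirL : C₁ := ⟨-1, by decide⟩

/-- The matrix with rows `(a, b)` and `(-b̄, ā)`. -/
noncomputable def coinMatrix (a b : ℂ) : Matrix (Fin 2) (Fin 2) ℂ :=
  !![a, b; -(starRingEnd ℂ) b, (starRingEnd ℂ) a]

/-- The order of the internal states in the coin matrix: first `R`, then `L`. -/
def coinIndex (σ : C₁) : Fin 2 := if σ = dirR then 0 else 1

/-- The coin matrix as a matrix indexed by the internal states. -/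
noncomputable def coin (a b : ℂ) : Matrix C₁ C₁ ℂ :=
  (coinMatrix a b).submatrix coinIndex coinIndex

/-- The absorbing set of the finite walk: both internal states at the sites `0` and `n`. -/
def boundary (n : ℕ) : Set (ℤ × C₁) := {x | x.1 = 0 ∨ x.1 = (n : ℤ)}

/-- The absorbing states at the left boundary site `0`. -/
def leftBoundary : Finset (ℤ × C₁) := {(0, dirR), (0, dirL)}

/-- The initial state `|m⟩(α|R⟩ + β|L⟩)`. -/
noncomputable def initialState (m : ℕ) (α β : ℂ) : StateSpace C₁ :=
  α • ket ((m : ℤ), dirR) + β • ket ((m : ℤ), dirL)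

/-- The probability that the walk `(ℤ, C₁, U, {0, n})` started in `|m⟩(α|R⟩ + β|L⟩)` is absorbed
at the site `0` at time `t + 1`. -/
noncomputable def leftTerm (a b : ℂ) (n m : ℕ) (α β : ℂ) (t : ℕ) : ℝ :=
  absorptionTerm (coin a b) (boundary n) leftBoundary (initialState m α β) t

/-- The left-absorption probability `P_n^{(m)}(α, β)`. -/
noncomputable def leftProb (a b : ℂ) (n m : ℕ) (α β : ℂ) : ℝ :=
  ∑' t : ℕ, leftTerm a b n m α β t

/-- The summand `⟨0,L|Q(Π Q)^t|m,R⟩ * conj ⟨0,L|Q(Π Q)^t|m,L⟩` of the cross term. -/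
noncomputable def crossSummand (a b : ℂ) (n m : ℕ) (t : ℕ) : ℂ :=
  hitAmplitude (coin a b) (boundary n) (ket ((m : ℤ), dirR)) (0, dirL) t *
    (starRingEnd ℂ)
      (hitAmplitude (coin a b) (boundary n) (ket ((m : ℤ), dirL)) (0, dirL) t)

/-- The cross term `H_n^{(m)}`. -/
noncomputable def crossTerm (a b : ℂ) (n m : ℕ) : ℂ :=
  ∑' t : ℕ, crossSummand a b n m t

/-- `R_k = (1 + |b|)^k - (1 - |b|)^k`. -/
noncomputable def seqR (b : ℂ) (k : ℕ) : ℝ := (1 + ‖b‖) ^ k - (1 - ‖b‖) ^ k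

/-- `B_k = (1 + |b|)^k + (1 - |b|)^k`. -/
noncomputable def seqB (b : ℂ) (k : ℕ) : ℝ := (1 + ‖b‖) ^ k + (1 - ‖b‖) ^ k

end QuantumWalk

open QuantumWalk

/-!
Write `r = |b|²`, so `1 - r = |a|²`, and `k = n - 1` for the number of interior sites.

Only the state `(0, L)` is ever reached at the site `0`. Up to explicit constant factors, the
amplitudes of reaching it from `(i + 1, R)` and `(i + 1, L)` are real numbers `ρR i t`, `ρL i t`
obeying a linear recursion in the time `t` (`reducedAmplitude`, `hitAmplitude_dirL_eq`). Their
generating functions solve the recursion in closed form (`circleCoeff_gen`): with `w = z²`,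
`∑ ρR i t z^t = z^i S_{k-i}(w) / D_k(w)` and `∑ ρL i t z^t = z^i D_{k-1-i}(w) / D_k(w)`,
where the polynomials `S_j`, `D_j` satisfy `S_{j+1} = w S_j + D_j`, `D_{j+1} = r w S_j + D_j`.
The inequality `|D_j|² - r |S_j|² ≥ (1 - r)^j` on the closed unit disc, an equality on the circle,
shows that `D_k` has no zero there. So the generating functions are analytic on the closed disc,
their coefficients are absolutely summable, and by Parseval (`hasSum_circleCoeff_mul_conj`) the
three series are averages over the unit circle of `|S_q|² / |D_k|²` and `1 / |D_k|²`.

These averages are computed by the mean value property. The Casoratian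
`D_i S_{i+j} - D_{i+j} S_i = ((1 - r) w)^i S_j` and the reflection symmetry of `S_j`, `D_j` on the
circle give, for `|w| = 1` and `w ≠ 1`,
`(1 - r)^i |S_j|² / |D_{i+j}|² = Re (2 w S_j D_i / ((w - 1) D_{i+j}))`.
The right-hand side has a pole at `w = 1`. Subtracting a real multiple `2 κ` of
`(1 + w) / (w - 1)`, which is purely imaginary on the circle, removes it, and the value `2 κ` of
the resulting analytic function at `0` is the average (`circleAverage_scatterS_div`). The constant
`2 κ = S_j(1) D_i(1) / D_{i+j}(1)` is where `(1 ± |b|)^j` enters: these are the powers of the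
eigenvalues of the recursion at `w = 1`.
-/

namespace QuantumWalk

open ComplexConjugate Metric

variable {r : ℝ}

/-! ### The scattering polynomials -/

/-- The pair `(S_j(w), D_j(w))` of scattering polynomials of a segment of `j` sites with an
absorbing right end, where `r = |b|²` and `w` is the square of the generating function variable.
Solving the stationary equations from the right, one site at a time, multiplies the pair by the
matrix with rows `(w, 1)` and `(r w, 1)`. -/
noncomputable def scatterPair (r w : ℂ) : ℕ → ℂ × ℂ
  | 0 => (0, 1)
  | j + 1 => (w * (scatterPair r w j).1 + (scatterPair r w j).2,
      r * w * (scatterPair r w j).1 + (scatterPair r w j).2)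

/-- The polynomial `S_j(w)`, proportional to the amplitude of reflection from a segment of `j`
sites. -/
noncomputable abbrev scatterS (r w : ℂ) (j : ℕ) : ℂ := (scatterPair r w j).1

/-- The polynomial `D_j(w)`, the common denominator of the generating functions of a segment of `j`
sites. -/
noncomputable abbrev scatterD (r w : ℂ) (j : ℕ) : ℂ := (scatterPair r w j).2

theorem scatterS_succ (r w : ℂ) (j : ℕ) :
    scatterS r w (j + 1) = w * scatterS r w j + scatterD r w j := rfl

theorem scatterD_succ (r w : ℂ) (j : ℕ) :
    scatterD r w (j + 1) = r * w * scatterS r w j + scatterD r w j := rfl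

theorem scatterD_zero_arg (r : ℂ) (j : ℕ) : scatterD r 0 j = 1 := by
  induction j with
  | zero => rfl
  | succ j ih => rw [scatterD_succ, ih]; ring

theorem differentiable_scatterPair (r : ℂ) (j : ℕ) :
    (Differentiable ℂ fun w => scatterS r w j) ∧ Differentiable ℂ fun w => scatterD r w j := by
  induction j with
  | zero =>
    refine ⟨?_, ?_⟩
    · exact differentiable_const (0 : ℂ)
    · exact differentiable_const (1 : ℂ)
  | succ j ih =>
    obtain ⟨h1, h2⟩ := ih
    refine ⟨?_, ?_⟩
    · simp only [scatterS_succ]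
      exact (differentiable_id.mul h1).add h2
    · simp only [scatterD_succ]
      exact ((differentiable_id.const_mul r).mul h1).add h2

@[fun_prop]
theorem differentiable_scatterS (r : ℂ) (j : ℕ) : Differentiable ℂ fun w => scatterS r w j :=
  (differentiable_scatterPair r j).1

@[fun_prop]
theorem differentiable_scatterD (r : ℂ) (j : ℕ) : Differentiable ℂ fun w => scatterD r w j :=
  (differentiable_scatterPair r j).2

/-- The Casoratian of the recursion: each step has determinant `(1 - r) w`. -/
theorem scatter_casorati (r w : ℂ) (i j : ℕ) :
    scatterD r w i * scatterS r w (i + j) - scatterD r w (i + j) * scatterS r w i =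
      ((1 - r) * w) ^ i * scatterS r w j := by
  induction i with
  | zero => simp [scatterD, scatterS, scatterPair]
  | succ i ih =>
    rw [show i + 1 + j = i + j + 1 by ring, scatterS_succ, scatterS_succ, scatterD_succ,
      scatterD_succ, pow_succ]
    linear_combination (1 - r) * w * ih

/-- The step multiplies the indefinite form `|y|² - r |x|²` by `1 - r`, once the first coordinate
has been multiplied by `w`. Dropping the factor `|w|²` changes nothing for `|w| = 1` and can only
decrease the form for `|w| ≤ 1`. -/
theorem scatter_sq_sub_succ (r : ℝ) (w : ℂ) (j : ℕ) :
    ‖scatterD r w (j + 1)‖ ^ 2 - r * ‖scatterS r w (j + 1)‖ ^ 2 =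
      (1 - r) * (‖scatterD r w j‖ ^ 2 - r * (‖w‖ ^ 2 * ‖scatterS r w j‖ ^ 2)) := by
  rw [scatterS_succ, scatterD_succ]
  rw [← mul_pow, ← norm_mul, mul_assoc]
  generalize w * scatterS r w j = x
  generalize scatterD r w j = y
  simp only [Complex.sq_norm, Complex.normSq_apply, Complex.add_re, Complex.add_im,
    Complex.re_ofReal_mul, Complex.im_ofReal_mul]
  ring

theorem scatter_sq_sub_ge {r : ℝ} (hr0 : 0 ≤ r) (hr1 : r ≤ 1) {w : ℂ} (hw : ‖w‖ ≤ 1) (j : ℕ) :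
    (1 - r) ^ j ≤ ‖scatterD r w j‖ ^ 2 - r * ‖scatterS r w j‖ ^ 2 := by
  induction j with
  | zero => simp [scatterD, scatterS, scatterPair]
  | succ j ih =>
    rw [scatter_sq_sub_succ, pow_succ']
    refine mul_le_mul_of_nonneg_left (ih.trans ?_) (by linarith)
    have h1 : ‖w‖ ^ 2 ≤ 1 := pow_le_one₀ (norm_nonneg _) hw
    have h2 : ‖w‖ ^ 2 * ‖scatterS r w j‖ ^ 2 ≤ ‖scatterS r w j‖ ^ 2 :=
      mul_le_of_le_one_left (by positivity) h1
    have := mul_le_mul_of_nonneg_left h2 hr0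
    linarith

theorem scatter_sq_sub_eq (r : ℝ) {w : ℂ} (hw : ‖w‖ = 1) (j : ℕ) :
    ‖scatterD r w j‖ ^ 2 - r * ‖scatterS r w j‖ ^ 2 = (1 - r) ^ j := by
  induction j with
  | zero => simp [scatterD, scatterS, scatterPair]
  | succ j ih => rw [scatter_sq_sub_succ, pow_succ' (1 - r), ← ih, hw]; ring

theorem scatterD_ne_zero {r : ℝ} (hr0 : 0 ≤ r) (hr1 : r < 1) {w : ℂ} (hw : ‖w‖ ≤ 1) (j : ℕ) :
    scatterD r w j ≠ 0 := by
  intro h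
  have h1 := scatter_sq_sub_ge hr0 hr1.le hw j
  have h2 : 0 < (1 - r) ^ j := pow_pos (by linarith) j
  have h3 : 0 ≤ r * ‖scatterS r w j‖ ^ 2 := by positivity
  rw [h] at h1
  simp at h1
  linarith

/-- Reflection symmetry on the unit circle, where `conj w = w⁻¹`: there `w^((1 - j) / 2) S_j(w)` is
real. The factors `w ^ j` clear the denominators. -/
theorem scatter_conj (r : ℝ) {w : ℂ} (hw : ‖w‖ = 1) (j : ℕ) :
    conj (scatterS r w j) * w ^ j = w * scatterS r w j ∧
    conj (scatterD r w j) * w ^ j = scatterD r w j + (w - 1) * scatterS r w j := by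
  have hc : conj w * w = 1 := by
    rw [mul_comm, Complex.mul_conj, Complex.normSq_eq_norm_sq, hw]; simp
  induction j with
  | zero => simp [scatterD, scatterS, scatterPair]
  | succ j ih =>
    obtain ⟨h1, h2⟩ := ih
    rw [scatterS_succ, scatterD_succ]
    simp only [map_add, map_mul, Complex.conj_ofReal, pow_succ]
    constructor
    · linear_combination (conj (scatterS r w j) * w ^ j) * hc + h1 + w * h2
    · linear_combination (r * conj (scatterS r w j) * w ^ j) * hc + r * h1 + w * h2

/-- On the unit circle the quotient `|S_j|² / |D_{i+j}|²` is the real part of a function which is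
analytic in the disc, up to a pole at `w = 1`. -/
theorem re_scatter_quotient (r : ℝ) {w : ℂ} (hw : ‖w‖ = 1) (hw1 : w ≠ 1) (i j : ℕ)
    (hD : scatterD r w (i + j) ≠ 0) :
    (2 * (w * scatterS r w j * scatterD r w i / ((w - 1) * scatterD r w (i + j)))).re =
      (1 - r) ^ i * ‖scatterS r w j‖ ^ 2 / ‖scatterD r w (i + j)‖ ^ 2 := by
  have hw0 : w ≠ 0 := by
    rintro rfl
    simp at hw
  have hc : conj w * w = 1 := by
    rw [mul_comm, Complex.mul_conj, Complex.normSq_eq_norm_sq, hw]; simp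
  have hw1' : w - 1 ≠ 0 := sub_ne_zero.2 hw1
  have hcw : conj w - 1 ≠ 0 := by
    intro h
    apply hw1'
    have := congrArg conj h
    simpa using this
  have hcD : conj (scatterD r w (i + j)) ≠ 0 := by simpa using hD
  apply Complex.ofReal_injective
  set Q := w * scatterS r w j * scatterD r w i / ((w - 1) * scatterD r w (i + j)) with hQ
  have hre : (((2 * Q).re : ℝ) : ℂ) = Q + conj Q := by
    rw [Complex.add_conj]; simp
  rw [hre]
  push_cast
  rw [← Complex.mul_conj', ← Complex.mul_conj', hQ]
  simp only [map_div₀, map_mul, map_sub, map_one]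
  obtain ⟨a1, -⟩ := scatter_conj r hw j
  obtain ⟨a2, a3⟩ := scatter_conj r hw i
  obtain ⟨-, a4⟩ := scatter_conj r hw (i + j)
  have cas := scatter_casorati r w i j
  generalize hs : scatterS r w j = s at *
  generalize hk : scatterD r w (i + j) = K at *
  generalize hks : scatterS r w (i + j) = T at *
  generalize hi : scatterD r w i = E at *
  generalize his : scatterS r w i = F at *
  rw [div_add_div _ _ (mul_ne_zero hw1' hD) (mul_ne_zero hcw hcD),
    div_eq_div_iff (mul_ne_zero (mul_ne_zero hw1' hD) (mul_ne_zero hcw hcD))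
      (mul_ne_zero hD hcD)]
  -- Multiplying by `w ^ (i + j)` turns all conjugates into polynomials; the rest is the Casoratian.
  have key : w ^ i * w ^ j * ((w * s * E) * ((conj w - 1) * conj K) +
      (w - 1) * K * (conj w * conj s * conj E)) =
      w ^ i * w ^ j * ((1 - r) ^ i * (s * conj s) * ((w - 1) * (conj w - 1))) := by
    rw [pow_add] at a4
    rw [mul_pow] at cas
    linear_combination (w * s * E * (conj w - 1)) * a4 +
      (w - 1) * K * conj w * (conj E * w ^ i * a1 + w * s * a3) -
      ((1 - r) ^ i * s * w ^ i * (w - 1) * (conj w - 1)) * a1 +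
      (s * E * (K + (w - 1) * T) + (w - 1) * K * s * (E + (w - 1) * F) -
        (1 - r) ^ i * s ^ 2 * w ^ i * (w - 1)) * hc - (w - 1) ^ 2 * s * cas
  have key' := mul_left_cancel₀ (mul_ne_zero (pow_ne_zero i hw0) (pow_ne_zero j hw0)) key
  linear_combination (K * conj K) * key'

/-! ### Fourier coefficients of analytic functions on the unit circle -/

/-- A function analytic on a neighbourhood of the closed unit disc has absolutely summable Taylor
coefficients. -/
theorem _root_.AnalyticOnNhd.exists_hasSum_sphere {f : ℂ → ℂ}
    (hf : AnalyticOnNhd ℂ f (closedBall 0 1)) :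
    ∃ c : ℕ → ℂ, (Summable fun t => ‖c t‖) ∧
      ∀ z ∈ sphere (0 : ℂ) 1, HasSum (fun t => c t * z ^ t) (f z) := by
  obtain ⟨δ, hδ, hsub⟩ := (isCompact_closedBall (0 : ℂ) 1).exists_thickening_subset_open
    (isOpen_analyticAt ℂ f) (fun z hz => hf z hz)
  rw [thickening_closedBall hδ zero_le_one] at hsub
  have hd : DifferentiableOn ℂ f (ball 0 (δ + 1)) :=
    fun z hz => (hsub hz).differentiableAt.differentiableWithinAt
  have hs : ∀ z ∈ sphere (0 : ℂ) 1,
      HasSum (fun t => ((t.factorial : ℂ)⁻¹ * iteratedDeriv t f 0) * z ^ t) (f z) := by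
    intro z hz
    have hz' : z ∈ ball (0 : ℂ) (δ + 1) := by
      rw [mem_sphere_zero_iff_norm] at hz
      rw [mem_ball_zero_iff]
      linarith
    refine (Complex.hasSum_taylorSeries_on_ball hd hz').congr_fun fun t => ?_
    simp only [sub_zero, smul_eq_mul]
    ring
  refine ⟨_, ?_, hs⟩
  -- The Taylor series converges at `z = 1`, and summability in `ℂ` is absolute.
  have h1 := (hs 1 (by simp)).summable.norm
  simpa using h1

/-- Termwise averaging of an absolutely convergent power series against a continuous function. -/
theorem hasSum_circleAverage_mul {f g : ℂ → ℂ} {c : ℕ → ℂ} (hc : Summable fun t => ‖c t‖)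
    (hf : ∀ z ∈ sphere (0 : ℂ) 1, HasSum (fun t => c t * z ^ t) (f z))
    (hg : ContinuousOn g (sphere 0 1)) :
    HasSum (fun t => c t * Real.circleAverage (fun z => z ^ t * g z) 0 1)
      (Real.circleAverage (fun z => f z * g z) 0 1) := by
  obtain ⟨C, hC⟩ := (isCompact_sphere (0 : ℂ) 1).exists_bound_of_continuousOn hg
  have hmem : ∀ θ : ℝ, circleMap 0 1 θ ∈ sphere (0 : ℂ) 1 :=
    circleMap_mem_sphere 0 zero_le_one
  have hgc : Continuous fun θ : ℝ => g (circleMap 0 1 θ) :=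
    hg.comp_continuous (continuous_circleMap 0 1) hmem
  have hmain : HasSum
      (fun t => ∫ θ in (0 : ℝ)..2 * Real.pi, c t * (circleMap 0 1 θ ^ t * g (circleMap 0 1 θ)))
      (∫ θ in (0 : ℝ)..2 * Real.pi, f (circleMap 0 1 θ) * g (circleMap 0 1 θ)) := by
    refine intervalIntegral.hasSum_integral_of_dominated_convergence
      (fun t _ => ‖c t‖ * C) (fun t => ?_) (fun t => ?_) ?_ ?_ ?_
    · exact (continuous_const.mul
        (((continuous_circleMap 0 1).pow t).mul hgc)).aestronglyMeasurable
    · refine .of_forall fun θ _ => ?_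
      rw [norm_mul, norm_mul, norm_pow, norm_circleMap_zero]
      simpa using mul_le_mul_of_nonneg_left (hC _ (hmem θ)) (norm_nonneg (c t))
    · exact .of_forall fun _ _ => hc.mul_right C
    · exact intervalIntegrable_const
    · refine .of_forall fun θ _ => ?_
      refine ((hf _ (hmem θ)).mul_right (g (circleMap 0 1 θ))).congr_fun fun t => ?_
      ring
  have h2 := hmain.const_smul ((2 * Real.pi)⁻¹ : ℝ)
  refine h2.congr_fun fun t => ?_
  rw [Real.circleAverage_def, intervalIntegral.integral_const_mul, mul_smul_comm]

/-- The `t`-th Fourier coefficient of `f` on the unit circle, for `t ≥ 0`; on the circle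
`conj (z ^ t) = z ^ (-t)`. -/
noncomputable def circleCoeff (f : ℂ → ℂ) (t : ℕ) : ℂ :=
  Real.circleAverage (fun z => f z * conj (z ^ t)) 0 1

theorem circleAverage_conj (f : ℂ → ℂ) :
    Real.circleAverage (fun z => conj (f z)) 0 1 = conj (Real.circleAverage f 0 1) := by
  rw [Real.circleAverage_def, Real.circleAverage_def,
    intervalIntegral.integral_of_le Real.two_pi_pos.le,
    intervalIntegral.integral_of_le Real.two_pi_pos.le, integral_conj,
    Complex.real_smul, Complex.real_smul, map_mul, Complex.conj_ofReal]

theorem circleCoeff_pow (s t : ℕ) : circleCoeff (fun z => z ^ s) t = if s = t then 1 else 0 := by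
  have key : ∀ d : ℕ, Real.circleAverage (fun z : ℂ => z ^ d) 0 1 = if d = 0 then 1 else 0 := by
    intro d
    rw [(differentiable_id.pow d).diffContOnCl.circleAverage]
    simp [zero_pow_eq]
  have hn : ∀ z ∈ sphere (0 : ℂ) |1|, ∀ d, z ^ d * conj (z ^ d) = 1 := by
    intro z hz d
    rw [abs_one, mem_sphere_zero_iff_norm] at hz
    rw [Complex.mul_conj', norm_pow, hz]
    simp
  rcases le_total t s with h | h
  · obtain ⟨d, rfl⟩ := Nat.exists_eq_add_of_le h
    rw [circleCoeff, Real.circleAverage_congr_sphere (f₂ := fun z => z ^ d), key]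
    · simp
    · intro z hz
      simp only
      rw [pow_add]
      linear_combination z ^ d * hn z hz t
  · obtain ⟨d, rfl⟩ := Nat.exists_eq_add_of_le h
    rw [circleCoeff, Real.circleAverage_congr_sphere (f₂ := fun z => conj (z ^ d)),
      circleAverage_conj, key]
    · by_cases hd : d = 0 <;> simp [hd]
    · intro z hz
      simp only
      rw [pow_add, map_mul]
      linear_combination conj (z ^ d) * hn z hz s

theorem circleAverage_pow_mul_conj (g : ℂ → ℂ) (t : ℕ) :
    Real.circleAverage (fun z => z ^ t * conj (g z)) 0 1 = conj (circleCoeff g t) := by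
  rw [circleCoeff, ← circleAverage_conj]
  congr 1
  funext z
  simp [mul_comm]

/-- Parseval's identity. Analyticity of `f` makes its negative Fourier coefficients vanish, so those
of `g` do not matter. -/
theorem hasSum_circleCoeff_mul_conj {f g : ℂ → ℂ} (hf : AnalyticOnNhd ℂ f (closedBall 0 1))
    (hg : ContinuousOn g (sphere 0 1)) :
    HasSum (fun t => circleCoeff f t * conj (circleCoeff g t))
      (Real.circleAverage (fun z => f z * conj (g z)) 0 1) := by
  obtain ⟨c, hc, hs⟩ := hf.exists_hasSum_sphere
  have hcoeff : ∀ t, circleCoeff f t = c t := by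
    intro t
    have h := hasSum_circleAverage_mul hc hs (g := fun z => conj (z ^ t))
      (Complex.continuous_conj.comp (continuous_pow t)).continuousOn
    have h2 : ∀ s, Real.circleAverage (fun z : ℂ => z ^ s * conj (z ^ t)) 0 1 =
        if s = t then 1 else 0 := fun s => circleCoeff_pow s t
    simp only [h2] at h
    have h3 := hasSum_ite_eq t (c t)
    refine h.unique (h3.congr_fun fun s => ?_)
    by_cases hst : s = t <;> simp [hst]
  have h := hasSum_circleAverage_mul hc hs (g := fun z => conj (g z))
    (Complex.continuous_conj.comp_continuousOn hg)
  simpa only [circleAverage_pow_mul_conj, ← hcoeff] using h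

theorem _root_.AnalyticOnNhd.circleAverage_eq {f : ℂ → ℂ}
    (hf : AnalyticOnNhd ℂ f (closedBall 0 1)) : Real.circleAverage f 0 1 = f 0 := by
  refine DiffContOnCl.circleAverage (hf.differentiableOn.diffContOnCl_ball ?_)
  simp

theorem circleCoeff_zero_of_eq {f h : ℂ → ℂ} {C : ℂ}
    (hh : AnalyticOnNhd ℂ h (closedBall 0 1)) (hf : ∀ z ∈ sphere (0 : ℂ) 1, f z = C + z * h z) :
    circleCoeff f 0 = C := by
  rw [circleCoeff, Real.circleAverage_congr_sphere (f₂ := fun z => C + z * h z)]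
  · have h1 : AnalyticOnNhd ℂ (fun z => C + z * h z) (closedBall 0 1) :=
      analyticOnNhd_const.add (analyticOnNhd_id.mul hh)
    rw [h1.circleAverage_eq]
    simp
  · intro z hz
    rw [abs_one] at hz
    simp [hf z hz]

theorem circleCoeff_succ_of_eq {f h : ℂ → ℂ} {C : ℂ}
    (hh : ContinuousOn h (sphere 0 1)) (hf : ∀ z ∈ sphere (0 : ℂ) 1, f z = C + z * h z) (t : ℕ) :
    circleCoeff f (t + 1) = circleCoeff h t := by
  have hC : Real.circleAverage (fun z => C * conj (z ^ (t + 1))) 0 1 = 0 := by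
    have := circleCoeff_pow 0 (t + 1)
    rw [circleCoeff] at this
    simp only [pow_zero, one_mul] at this
    simp only [← smul_eq_mul]
    rw [Real.circleAverage_fun_smul, this]
    simp
  have h1 : ContinuousOn (fun z : ℂ => C * conj (z ^ (t + 1))) (sphere 0 1) := by fun_prop
  have h2 : ContinuousOn (fun z => h z * conj (z ^ t)) (sphere 0 1) :=
    hh.mul (Complex.continuous_conj.comp (continuous_pow t)).continuousOn
  rw [circleCoeff, circleCoeff, Real.circleAverage_congr_sphere
    (f₂ := fun z => C * conj (z ^ (t + 1)) + h z * conj (z ^ t)),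
    Real.circleAverage_fun_add (h1.circleIntegrable zero_le_one)
      (h2.circleIntegrable zero_le_one), hC, zero_add]
  intro z hz
  rw [abs_one] at hz
  have hz1 : z * conj z = 1 := by
    rw [mem_sphere_zero_iff_norm] at hz
    rw [Complex.mul_conj', hz]
    simp
  simp only [hf z hz, pow_succ, map_mul]
  linear_combination (h z * conj (z ^ t)) * hz1

/-! ### The circle average of a scattering quotient -/

theorem eventually_sq_ne_one :
    ∀ᶠ z in Filter.codiscreteWithin (sphere (0 : ℂ) |1|), z ^ 2 ≠ 1 := by
  refine codiscreteWithin_iff_locallyFiniteComplementWithin.2 fun z _ =>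
    ⟨Set.univ, Filter.univ_mem, Set.Finite.subset (Set.toFinite {1, -1}) ?_⟩
  rintro x ⟨-, -, hx⟩
  exact sq_eq_one_iff.1 (not_not.1 hx)

/-- The average of `(1 - r)^i |S_j|² / |D_{i+j}|²` over the circle. -/
theorem circleAverage_scatterS_div {r : ℝ} (hr0 : 0 ≤ r) (hr1 : r < 1) (i j : ℕ) :
    Real.circleAverage (fun z =>
      (1 - r) ^ i * ‖scatterS r (z ^ 2) j‖ ^ 2 / ‖scatterD r (z ^ 2) (i + j)‖ ^ 2) 0 1 =
      (scatterS r 1 j * scatterD r 1 i / scatterD r 1 (i + j)).re := by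
  -- The constant for which the numerator `N` below vanishes at `w = 1`.
  set κ : ℂ := scatterS r 1 j * scatterD r 1 i / (2 * scatterD r 1 (i + j)) with hκ
  have hD1 : scatterD r 1 (i + j) ≠ 0 := scatterD_ne_zero hr0 hr1 (by simp) _
  set N : ℂ → ℂ := fun w => κ * (1 + w) * scatterD r w (i + j) -
    w * scatterS r w j * scatterD r w i with hN
  have hNd : Differentiable ℂ N := by fun_prop
  have hN1 : N 1 = 0 := by
    simp only [hN, hκ]
    field_simp
    ring
  have hQd : Differentiable ℂ (dslope N 1) := by
    rw [← differentiableOn_univ, Complex.differentiableOn_dslope Filter.univ_mem]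
    exact hNd.differentiableOn
  -- `dslope N 1 w` is `N w / (w - 1)` with the removable singularity at `1` filled in.
  set Φ : ℂ → ℂ := fun z => -2 * dslope N 1 (z ^ 2) / scatterD r (z ^ 2) (i + j) with hΦ
  have hΦd : AnalyticOnNhd ℂ Φ (closedBall 0 1) := by
    intro z hz
    have hz' : ‖z ^ 2‖ ≤ 1 := by
      rw [norm_pow]
      exact pow_le_one₀ (norm_nonneg _) (by simpa using hz)
    refine AnalyticAt.div ?_ ?_ (scatterD_ne_zero hr0 hr1 hz' _)
    · exact Differentiable.analyticAt
        ((hQd.comp (differentiable_id.pow 2)).const_mul (-2)) z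
    · exact Differentiable.analyticAt
        ((differentiable_scatterD r (i + j)).comp (differentiable_id.pow 2)) z
  have hΦ0 : Φ 0 = 2 * κ := by
    simp only [hΦ]
    rw [zero_pow two_ne_zero, dslope_of_ne _ zero_ne_one, slope_def_field, hN1, scatterD_zero_arg]
    simp [hN, scatterD_zero_arg, div_neg]
  have hcongr : (fun z => (1 - r) ^ i * ‖scatterS r (z ^ 2) j‖ ^ 2 /
      ‖scatterD r (z ^ 2) (i + j)‖ ^ 2) =ᶠ[Filter.codiscreteWithin (sphere (0 : ℂ) |1|)]
      (Complex.reCLM ∘ Φ) := by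
    filter_upwards [eventually_sq_ne_one, Filter.self_mem_codiscreteWithin _] with z hz1 hz
    rw [abs_one, mem_sphere_zero_iff_norm] at hz
    have hw : ‖z ^ 2‖ = 1 := by rw [norm_pow, hz, one_pow]
    change _ = (-2 * dslope N 1 (z ^ 2) / scatterD r (z ^ 2) (i + j)).re
    generalize z ^ 2 = w at *
    have hD := scatterD_ne_zero hr0 hr1 hw.le (i + j)
    have hw1 : w - 1 ≠ 0 := sub_ne_zero.2 hz1
    rw [← re_scatter_quotient r hw hz1 i j hD]
    have hsplit : dslope N 1 w = (κ * (1 + w) * scatterD r w (i + j) -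
        w * scatterS r w j * scatterD r w i) / (w - 1) := by
      rw [dslope_of_ne _ hz1, slope_def_field, hN1, sub_zero]
    have hk : conj κ = κ := by
      have h1 := fun j => scatter_conj r (norm_one (α := ℂ)) j
      simp only [one_pow, mul_one, one_mul, sub_self, zero_mul, add_zero] at h1
      simp only [hκ, map_div₀, map_mul, (h1 _).1, (h1 _).2, map_ofNat]
    -- The subtracted function is purely imaginary on the circle.
    have hpole : (κ * ((1 + w) / (w - 1))).re = 0 := by
      have hc : conj w * w = 1 := by
        rw [mul_comm, Complex.mul_conj', hw]
        simp
      have hcw : conj w - 1 ≠ 0 := by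
        intro h
        apply hw1
        simpa using congrArg conj h
      have h2 : conj (κ * ((1 + w) / (w - 1))) = -(κ * ((1 + w) / (w - 1))) := by
        simp only [map_mul, map_div₀, map_add, map_sub, map_one, hk]
        field_simp
        linear_combination 2 * κ * hc
      have h3 := congrArg Complex.re h2
      rw [Complex.conj_re, Complex.neg_re] at h3
      linarith
    have h4 : -2 * dslope N 1 w / scatterD r w (i + j) =
        2 * (w * scatterS r w j * scatterD r w i / ((w - 1) * scatterD r w (i + j))) -
        2 * (κ * ((1 + w) / (w - 1))) := by
      rw [hsplit]
      field_simp
      ring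
    have h5 : ((2 : ℂ) * (κ * ((1 + w) / (w - 1)))).re = 0 := by
      rw [Complex.mul_re, hpole]
      simp
    have h6 := congrArg Complex.re h4
    rw [Complex.sub_re, h5, sub_zero] at h6
    exact h6.symm
  rw [Real.circleAverage_congr_codiscreteWithin hcongr one_ne_zero,
    Complex.reCLM.circleAverage_comp_comm
      ((hΦd.continuousOn.mono sphere_subset_closedBall).circleIntegrable zero_le_one),
    hΦd.circleAverage_eq, hΦ0, hκ, Complex.reCLM_apply]
  congr 1
  field_simp

/-! ### Hitting amplitudes of the walk -/

theorem C₁_eq_or (σ : C₁) : σ = dirR ∨ σ = dirL := by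
  revert σ
  decide

theorem ket_apply {G : Type*} [DecidableEq G] {S : Finset G} (x y : G × S) :
    (ket x : StateSpace S) y = if y = x then 1 else 0 := by
  rw [ket, lp.coeFn_single]
  simp [Pi.single_apply]

theorem walkOp_apply {G : Type*} [AddGroup G] {S : Finset G} (U : Matrix S S ℂ)
    (ψ : StateSpace S) (x : G × S) :
    walkOp U ψ x = ∑ τ : S, U x.2 τ * ψ (-(x.2 : G) + x.1, τ) := rfl

theorem hitAmplitude_zero {G : Type*} [AddGroup G] {S : Finset G} (U : Matrix S S ℂ)
    (B : Set (G × S)) (ψ : StateSpace S) (x : G × S) :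
    hitAmplitude U B ψ x 0 = walkOp U ψ x := by
  simp [hitAmplitude]

theorem hitAmplitude_succ {G : Type*} [AddGroup G] {S : Finset G} (U : Matrix S S ℂ)
    (B : Set (G × S)) (ψ : StateSpace S) (x : G × S) (t : ℕ) :
    hitAmplitude U B ψ x (t + 1) = hitAmplitude U B (absorbingWalkOp U B ψ) x t := by
  rw [hitAmplitude, hitAmplitude, pow_succ, Module.End.mul_apply]

theorem hitAmplitude_add_smul {G : Type*} [AddGroup G] {S : Finset G} (U : Matrix S S ℂ)
    (B : Set (G × S)) (c d : ℂ) (ψ φ : StateSpace S) (x : G × S) (t : ℕ) :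
    hitAmplitude U B (c • ψ + d • φ) x t =
      c * hitAmplitude U B ψ x t + d * hitAmplitude U B φ x t := by
  simp only [hitAmplitude, map_add, map_smul]
  rfl

theorem hitAmplitude_zero_state {G : Type*} [AddGroup G] {S : Finset G} (U : Matrix S S ℂ)
    (B : Set (G × S)) (x : G × S) (t : ℕ) : hitAmplitude U B 0 x t = 0 := by
  simp only [hitAmplitude, map_zero]
  rfl

open Classical in
theorem noOp_ket {G : Type*} [DecidableEq G] {S : Finset G} (B : Set (G × S)) (x : G × S) :
    noOp B (ket x) = if x ∈ B then 0 else ket x := by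
  ext y
  have h : noOp B (ket x) y = if y ∈ B then 0 else (ket x : StateSpace S) y := rfl
  rw [h]
  by_cases hyx : y = x
  · subst hyx
    by_cases hy : y ∈ B <;> simp [hy]
  · rw [ket_apply, if_neg hyx, ite_self]
    split_ifs
    · rfl
    · rw [ket_apply, if_neg hyx]

theorem walkOp_coin_ket (a b : ℂ) (g : ℤ) (τ : C₁) :
    walkOp (coin a b) (ket (g, τ)) =
      coin a b dirR τ • ket (g + 1, dirR) + coin a b dirL τ • ket (g - 1, dirL) := by
  ext ⟨h, σ⟩
  have hsum : (coin a b dirR τ • ket (g + 1, dirR) + coin a b dirL τ • ket (g - 1, dirL) :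
      StateSpace C₁) (h, σ) = coin a b dirR τ * (ket (g + 1, dirR) : StateSpace C₁) (h, σ) +
        coin a b dirL τ * (ket (g - 1, dirL) : StateSpace C₁) (h, σ) := rfl
  rw [hsum, walkOp_apply]
  simp only [ket_apply, Prod.mk.injEq, mul_ite, mul_one, mul_zero]
  have hstep : ∀ υ : C₁, (if -(σ : ℤ) + h = g ∧ υ = τ then coin a b σ υ else 0) =
      if υ = τ then (if -(σ : ℤ) + h = g then coin a b σ τ else 0) else 0 := by
    intro υ
    by_cases h1 : υ = τ
    · subst h1; simp
    · simp [h1]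
  simp only [hstep, Finset.sum_ite_eq', Finset.mem_univ, if_true]
  have hne : dirR ≠ dirL := by decide
  rcases C₁_eq_or σ with rfl | rfl
  · simp only [and_true, hne, and_false, if_false, add_zero]
    refine if_congr ?_ rfl rfl
    change -(1 : ℤ) + h = g ↔ _
    omega
  · simp only [and_true, hne.symm, and_false, if_false, zero_add]
    refine if_congr ?_ rfl rfl
    change -(-1 : ℤ) + h = g ↔ _
    omega

open Classical in
theorem hitAmplitude_coin_ket_succ (a b : ℂ) (B : Set (ℤ × C₁)) (g : ℤ) (τ : C₁) (x : ℤ × C₁)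
    (t : ℕ) :
    hitAmplitude (coin a b) B (ket (g, τ)) x (t + 1) =
      coin a b dirR τ * (if (g + 1, dirR) ∈ B then 0 else
        hitAmplitude (coin a b) B (ket (g + 1, dirR)) x t) +
      coin a b dirL τ * (if (g - 1, dirL) ∈ B then 0 else
        hitAmplitude (coin a b) B (ket (g - 1, dirL)) x t) := by
  rw [hitAmplitude_succ, absorbingWalkOp, LinearMap.comp_apply, walkOp_coin_ket, map_add, map_smul,
    map_smul, hitAmplitude_add_smul, noOp_ket, noOp_ket]
  congr 2 <;> split_ifs <;> simp [hitAmplitude_zero_state]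

theorem coin_RR (a b : ℂ) : coin a b dirR dirR = a := by
  simp [coin, coinMatrix, coinIndex]

theorem coin_RL (a b : ℂ) : coin a b dirR dirL = b := by
  simp [coin, coinMatrix, coinIndex, show dirL ≠ dirR by decide]

theorem coin_LR (a b : ℂ) : coin a b dirL dirR = -conj b := by
  simp [coin, coinMatrix, coinIndex, show dirL ≠ dirR by decide]

theorem coin_LL (a b : ℂ) : coin a b dirL dirL = conj a := by
  simp [coin, coinMatrix, coinIndex, show dirL ≠ dirR by decide]

/-- The pair `(ρR i t, ρL i t)` of real amplitudes, as a function of the time `t` and then of `i`: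
the amplitude of first hitting the absorbing set at time `t + 1` in `(0, L)`, starting from
`(i + 1, R)` respectively `(i + 1, L)`, is the product of `-b̄ ā^i` respectively `ā^(i + 1)` with
this number. Here `r = |b|²`, the interior sites are `1, …, k`, and the recursion conditions on the
first step of the walk; the conditions `i + 1 < k` and `i ≠ 0` say that it is not absorbed. -/
noncomputable def reducedAmplitude (r : ℝ) (k : ℕ) : ℕ → ℕ → ℝ × ℝ
  | 0, i => if i = 0 then (1, 1) else (0, 0)
  | t + 1, i =>
    ((1 - r) * (if i + 1 < k then (reducedAmplitude r k t (i + 1)).1 else 0) +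
        (if i = 0 then 0 else (reducedAmplitude r k t (i - 1)).2),
      -r * (if i + 1 < k then (reducedAmplitude r k t (i + 1)).1 else 0) +
        (if i = 0 then 0 else (reducedAmplitude r k t (i - 1)).2))

theorem hitAmplitude_dirL_eq {a b : ℂ} (hab : ‖a‖ ^ 2 + ‖b‖ ^ 2 = 1) (k t i : ℕ) (hi : i < k) :
    hitAmplitude (coin a b) (boundary (k + 1)) (ket ((i : ℤ) + 1, dirR)) (0, dirL) t =
      -conj b * conj a ^ i * (reducedAmplitude (‖b‖ ^ 2) k t i).1 ∧
    hitAmplitude (coin a b) (boundary (k + 1)) (ket ((i : ℤ) + 1, dirL)) (0, dirL) t =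
      conj a ^ (i + 1) * (reducedAmplitude (‖b‖ ^ 2) k t i).2 := by
  have hne : dirL ≠ dirR := by decide
  have hbb : b * conj b = (‖b‖ : ℂ) ^ 2 := Complex.mul_conj' b
  have haa : a * conj a = 1 - (‖b‖ : ℂ) ^ 2 := by
    rw [Complex.mul_conj']
    exact_mod_cast eq_sub_of_add_eq hab
  induction t generalizing i with
  | zero =>
    simp only [hitAmplitude_zero, walkOp_coin_ket, coin_RR, coin_RL, coin_LR, coin_LL]
    have h : ∀ c d : ℂ, (c • ket ((i : ℤ) + 1 + 1, dirR) + d • ket ((i : ℤ) + 1 - 1, dirL) :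
        StateSpace C₁) (0, dirL) = if i = 0 then d else 0 := by
      intro c d
      change c * (ket ((i : ℤ) + 1 + 1, dirR) : StateSpace C₁) (0, dirL) +
        d * (ket ((i : ℤ) + 1 - 1, dirL) : StateSpace C₁) (0, dirL) = _
      rw [ket_apply, ket_apply]
      simp [hne, eq_comm]
    rw [h, h]
    by_cases hi0 : i = 0 <;> simp [hi0, reducedAmplitude]
  | succ t ih =>
    have hR : ((i : ℤ) + 1 + 1, dirR) ∈ boundary (k + 1) ↔ ¬ i + 1 < k := by
      simp only [boundary, Set.mem_ofPred_eq]
      omega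
    have hL : ((i : ℤ) + 1 - 1, dirL) ∈ boundary (k + 1) ↔ i = 0 := by
      simp only [boundary, Set.mem_ofPred_eq]
      omega
    simp only [hitAmplitude_coin_ket_succ, hR, hL, coin_RR, coin_RL, coin_LR, coin_LL,
      reducedAmplitude, ite_not]
    have e1 : (if i + 1 < k then hitAmplitude (coin a b) (boundary (k + 1))
        (ket ((i : ℤ) + 1 + 1, dirR)) (0, dirL) t else 0) = -conj b * conj a ^ (i + 1) *
        ((if i + 1 < k then (reducedAmplitude (‖b‖ ^ 2) k t (i + 1)).1 else 0 : ℝ) : ℂ) := by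
      split_ifs with h
      · exact_mod_cast (ih (i + 1) h).1
      · simp
    have e2 : (if i = 0 then 0 else hitAmplitude (coin a b) (boundary (k + 1))
        (ket ((i : ℤ) + 1 - 1, dirL)) (0, dirL) t) = conj a ^ i *
        ((if i = 0 then 0 else (reducedAmplitude (‖b‖ ^ 2) k t (i - 1)).2 : ℝ) : ℂ) := by
      split_ifs with h
      · simp
      · obtain ⟨j, rfl⟩ := Nat.exists_eq_succ_of_ne_zero h
        have := (ih j (by omega)).2
        simpa using this
    rw [e1, e2]
    set x := if i + 1 < k then (reducedAmplitude (‖b‖ ^ 2) k t (i + 1)).1 else 0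
    set y := if i = 0 then 0 else (reducedAmplitude (‖b‖ ^ 2) k t (i - 1)).2
    push_cast
    constructor
    · linear_combination (-conj b * conj a ^ i * x) * haa
    · linear_combination (-conj a ^ (i + 1) * x) * hbb

/-- The state `(0, R)` is entered only from the site `-1`, which a walk started in the interior
cannot reach without being absorbed. -/
theorem hitAmplitude_dirR_eq_zero (a b : ℂ) (k t i : ℕ) (hi : i < k) (τ : C₁) :
    hitAmplitude (coin a b) (boundary (k + 1)) (ket ((i : ℤ) + 1, τ)) (0, dirR) t = 0 := by
  have hne : dirR ≠ dirL := by decide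
  induction t generalizing i τ with
  | zero =>
    rw [hitAmplitude_zero, walkOp_coin_ket]
    change coin a b dirR τ * (ket ((i : ℤ) + 1 + 1, dirR) : StateSpace C₁) (0, dirR) +
      coin a b dirL τ * (ket ((i : ℤ) + 1 - 1, dirL) : StateSpace C₁) (0, dirR) = _
    rw [ket_apply, ket_apply, if_neg, if_neg]
    · simp
    · simp [hne]
    · simp only [Prod.mk.injEq, and_true]
      omega
  | succ t ih =>
    rw [hitAmplitude_coin_ket_succ]
    have e1 : (i + 1 + 1 : ℤ) = ((i + 1 : ℕ) : ℤ) + 1 := by push_cast; ring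
    split_ifs with h1 h2 h2
    · simp
    · obtain ⟨j, rfl⟩ : ∃ j, i = j + 1 := Nat.exists_eq_succ_of_ne_zero fun h => h2 (by
        simp [boundary, h])
      have := ih j (by omega) dirL
      rw [show ((j + 1 : ℕ) : ℤ) + 1 - 1 = (j : ℤ) + 1 by push_cast; ring, this]
      simp
    · have h3 : i + 1 < k := by
        simp only [boundary, Set.mem_ofPred_eq] at h1
        omega
      rw [e1, ih (i + 1) h3 dirR]
      simp
    · have h3 : i + 1 < k := by
        simp only [boundary, Set.mem_ofPred_eq] at h1
        omega
      obtain ⟨j, rfl⟩ : ∃ j, i = j + 1 := Nat.exists_eq_succ_of_ne_zero fun h => h2 (by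
        simp [boundary, h])
      rw [e1, ih (j + 1 + 1) h3 dirR,
        show ((j + 1 : ℕ) : ℤ) + 1 - 1 = (j : ℤ) + 1 by push_cast; ring, ih j (by omega) dirL]
      simp

/-! ### Generating functions of the reduced amplitudes -/

/-- The real values `(S_j(1), D_j(1))` of the scattering polynomials at the edge `w = 1`. -/
noncomputable def edgePair (r : ℝ) : ℕ → ℝ × ℝ
  | 0 => (0, 1)
  | j + 1 => ((edgePair r j).1 + (edgePair r j).2, r * (edgePair r j).1 + (edgePair r j).2)

theorem scatter_one (r : ℝ) (j : ℕ) :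
    scatterS r 1 j = (edgePair r j).1 ∧ scatterD r 1 j = (edgePair r j).2 := by
  induction j with
  | zero => simp [scatterS, scatterD, scatterPair, edgePair]
  | succ j ih =>
    rw [scatterS_succ, scatterD_succ, ih.1, ih.2]
    simp [edgePair]

theorem edgePair_add (r : ℝ) (i j : ℕ) :
    (edgePair r (i + j)).1 =
      (edgePair r i).1 * (edgePair r j).2 + (edgePair r i).2 * (edgePair r j).1 ∧
    (edgePair r (i + j)).2 =
      (edgePair r i).2 * (edgePair r j).2 + r * ((edgePair r i).1 * (edgePair r j).1) := by
  induction i with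
  | zero => simp [edgePair]
  | succ i ih =>
    rw [show i + 1 + j = i + j + 1 by ring]
    simp only [edgePair, ih.1, ih.2]
    constructor <;> ring

/-- The matrix with rows `(1, 1)` and `(β², 1)` has the eigenvalues `1 ± β`. -/
theorem edgePair_of_sq (β : ℝ) (j : ℕ) :
    2 * (β * (edgePair (β ^ 2) j).1) = (1 + β) ^ j - (1 - β) ^ j ∧
    2 * (edgePair (β ^ 2) j).2 = (1 + β) ^ j + (1 - β) ^ j := by
  induction j with
  | zero => simp [edgePair]; norm_num
  | succ j ih =>
    simp only [edgePair, pow_succ _ j]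
    constructor
    · linear_combination ih.1 + β * ih.2
    · linear_combination β * ih.1 + ih.2

/-- The generating function `∑ ρR i t z^t` in closed form; see `circleCoeff_gen`. The subtraction
`k - i` is meant for `i ≤ k`. -/
noncomputable def genR (r : ℝ) (k i : ℕ) (z : ℂ) : ℂ :=
  z ^ i * scatterS r (z ^ 2) (k - i) / scatterD r (z ^ 2) k

/-- The generating function `∑ ρL i t z^t` in closed form; see `circleCoeff_gen`. The subtraction
`k - 1 - i` is meant for `i < k`. -/
noncomputable def genL (r : ℝ) (k i : ℕ) (z : ℂ) : ℂ :=
  z ^ i * scatterD r (z ^ 2) (k - 1 - i) / scatterD r (z ^ 2) k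

theorem norm_pow_two_le_one {z : ℂ} (hz : z ∈ closedBall (0 : ℂ) 1) :
    ‖z ^ 2‖ ≤ 1 := by
  rw [norm_pow]
  exact pow_le_one₀ (norm_nonneg _) (by simpa using hz)


theorem analyticOnNhd_genR (hr0 : 0 ≤ r) (hr1 : r < 1) (k i : ℕ) :
    AnalyticOnNhd ℂ (genR r k i) (closedBall 0 1) := by
  intro z hz
  refine AnalyticAt.div ?_ ?_ (scatterD_ne_zero hr0 hr1 (norm_pow_two_le_one hz) _)
  · exact Differentiable.analyticAt ((differentiable_id.pow i).mul
      ((differentiable_scatterS r (k - i)).comp (differentiable_id.pow 2))) z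
  · exact Differentiable.analyticAt
      ((differentiable_scatterD r k).comp (differentiable_id.pow 2)) z

theorem analyticOnNhd_genL (hr0 : 0 ≤ r) (hr1 : r < 1) (k i : ℕ) :
    AnalyticOnNhd ℂ (genL r k i) (closedBall 0 1) := by
  intro z hz
  refine AnalyticAt.div ?_ ?_ (scatterD_ne_zero hr0 hr1 (norm_pow_two_le_one hz) _)
  · exact Differentiable.analyticAt ((differentiable_id.pow i).mul
      ((differentiable_scatterD r (k - 1 - i)).comp (differentiable_id.pow 2))) z
  · exact Differentiable.analyticAt
      ((differentiable_scatterD r k).comp (differentiable_id.pow 2)) z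

theorem circleCoeff_linear {f g : ℂ → ℂ} (hf : ContinuousOn f (sphere 0 1))
    (hg : ContinuousOn g (sphere 0 1)) (c d : ℂ) (t : ℕ) :
    circleCoeff (fun z => c * f z + d * g z) t = c * circleCoeff f t + d * circleCoeff g t := by
  have hp : ContinuousOn (fun z : ℂ => conj (z ^ t)) (sphere 0 1) :=
    (Complex.continuous_conj.comp (continuous_pow t)).continuousOn
  have h1 : ContinuousOn (fun z => c • (f z * conj (z ^ t))) (sphere 0 1) :=
    (hf.mul hp).const_smul c
  have h2 : ContinuousOn (fun z => d • (g z * conj (z ^ t))) (sphere 0 1) :=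
    (hg.mul hp).const_smul d
  have h3 := Real.circleAverage_fun_add (h1.circleIntegrable zero_le_one)
    (h2.circleIntegrable zero_le_one)
  rw [Real.circleAverage_fun_smul, Real.circleAverage_fun_smul] at h3
  rw [circleCoeff, circleCoeff, circleCoeff, ← smul_eq_mul c, ← smul_eq_mul d, ← h3]
  congr 1
  funext z
  simp only [smul_eq_mul]
  ring

/-- The generating functions satisfy the recursion of the reduced amplitudes. Since `S_0 = 0`, the
function `genR r k k` vanishes, as the absorbing right end requires. At `i = 0` the factor `0`
discards the term in which `i - 1` is truncated. -/
theorem genR_genL_step (hr0 : 0 ≤ r) (hr1 : r < 1) {k i : ℕ} (hi : i < k) {z : ℂ} (hz : ‖z‖ = 1) :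
    genR r k i z = (if i = 0 then 1 else 0) + z * ((1 - r) * genR r k (i + 1) z +
      (if i = 0 then 0 else 1) * genL r k (i - 1) z) ∧
    genL r k i z = (if i = 0 then 1 else 0) + z * (-r * genR r k (i + 1) z +
      (if i = 0 then 0 else 1) * genL r k (i - 1) z) := by
  obtain ⟨j, rfl⟩ : ∃ j, k = i + (j + 1) := ⟨k - i - 1, by omega⟩
  have hD : scatterD r (z ^ 2) (i + (j + 1)) ≠ 0 :=
    scatterD_ne_zero hr0 hr1 (by rw [norm_pow, hz, one_pow]) _
  have e1 : i + (j + 1) - i = j + 1 := by omega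
  have e2 : i + (j + 1) - (i + 1) = j := by omega
  have e3 : i + (j + 1) - 1 - i = j := by omega
  simp only [genR, genL, e1, e2, e3]
  rcases i with _ | i
  · simp only [zero_add] at hD ⊢
    simp only [if_true, zero_mul, add_zero, pow_zero, one_mul, pow_one]
    constructor
    · field_simp
      rw [scatterS_succ, scatterD_succ]
      ring
    · field_simp
      rw [scatterD_succ]
      ring
  · have e4 : i + 1 + (j + 1) - 1 - i = j + 1 := by omega
    simp only [Nat.add_sub_cancel, e4, Nat.succ_ne_zero, if_false, zero_add, one_mul]
    constructor
    · field_simp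
      rw [scatterS_succ, scatterD_succ]
      ring
    · field_simp
      rw [scatterD_succ]
      ring

theorem circleCoeff_gen (hr0 : 0 ≤ r) (hr1 : r < 1) {k : ℕ} (t i : ℕ) (hi : i < k) :
    circleCoeff (genR r k i) t = (reducedAmplitude r k t i).1 ∧
    circleCoeff (genL r k i) t = (reducedAmplitude r k t i).2 := by
  have hA : ∀ (i : ℕ) (c d : ℂ), AnalyticOnNhd ℂ
      (fun z => c * genR r k (i + 1) z + d * genL r k (i - 1) z) (closedBall 0 1) := fun i c d =>
    (analyticOnNhd_const.mul (analyticOnNhd_genR hr0 hr1 k (i + 1))).add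
      (analyticOnNhd_const.mul (analyticOnNhd_genL hr0 hr1 k (i - 1)))
  have hcR := fun i => (analyticOnNhd_genR hr0 hr1 k i).continuousOn.mono
    sphere_subset_closedBall
  have hcL := fun i => (analyticOnNhd_genL hr0 hr1 k i).continuousOn.mono
    sphere_subset_closedBall
  induction t generalizing i with
  | zero =>
    have hrec : ∀ z ∈ sphere (0 : ℂ) 1, _ := fun z hz =>
      genR_genL_step hr0 hr1 hi (mem_sphere_zero_iff_norm.1 hz)
    rw [circleCoeff_zero_of_eq (hA _ _ _) fun z hz => (hrec z hz).1,
      circleCoeff_zero_of_eq (hA _ _ _) fun z hz => (hrec z hz).2]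
    by_cases h : i = 0 <;> simp [h, reducedAmplitude]
  | succ t ih =>
    have hrec : ∀ z ∈ sphere (0 : ℂ) 1, _ := fun z hz =>
      genR_genL_step hr0 hr1 hi (mem_sphere_zero_iff_norm.1 hz)
    have hR : circleCoeff (genR r k (i + 1)) t =
        ((if i + 1 < k then (reducedAmplitude r k t (i + 1)).1 else 0 : ℝ) : ℂ) := by
      split_ifs with h
      · exact (ih (i + 1) h).1
      · have h0 : genR r k (i + 1) = fun _ => 0 := by
          funext z
          rw [genR, show k - (i + 1) = 0 by omega]
          simp [scatterS, scatterPair]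
        rw [h0, circleCoeff]
        simp [Real.circleAverage_def]
    have hL : (if i = 0 then 0 else 1) * circleCoeff (genL r k (i - 1)) t =
        ((if i = 0 then 0 else (reducedAmplitude r k t (i - 1)).2 : ℝ) : ℂ) := by
      split_ifs with h
      · simp
      · rw [(ih (i - 1) (by omega)).2, one_mul]
    rw [circleCoeff_succ_of_eq ((hA _ _ _).continuousOn.mono sphere_subset_closedBall)
        fun z hz => (hrec z hz).1,
      circleCoeff_succ_of_eq ((hA _ _ _).continuousOn.mono sphere_subset_closedBall)
        fun z hz => (hrec z hz).2,
      circleCoeff_linear (hcR _) (hcL _), circleCoeff_linear (hcR _) (hcL _), hR, hL]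
    simp only [reducedAmplitude]
    constructor <;> push_cast <;> rfl

/-! ### Sums of products of reduced amplitudes -/

/-- The average of `|S_q|² / |D_k|²` over the circle, in the variable `w = z²`. -/
noncomputable def meanS (r : ℝ) (k q : ℕ) : ℝ :=
  Real.circleAverage (fun z => ‖scatterS r (z ^ 2) q‖ ^ 2 / ‖scatterD r (z ^ 2) k‖ ^ 2) 0 1

/-- The average of `1 / |D_k|²` over the circle, in the variable `w = z²`. -/
noncomputable def meanInvD (r : ℝ) (k : ℕ) : ℝ :=
  Real.circleAverage (fun z => 1 / ‖scatterD r (z ^ 2) k‖ ^ 2) 0 1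

theorem pow_mul_meanS (hr0 : 0 ≤ r) (hr1 : r < 1) (i j : ℕ) :
    (1 - r) ^ i * meanS r (i + j) j =
      (edgePair r j).1 * (edgePair r i).2 / (edgePair r (i + j)).2 := by
  have h := circleAverage_scatterS_div hr0 hr1 i j
  rw [(scatter_one r j).1, (scatter_one r i).2, (scatter_one r (i + j)).2, ← Complex.ofReal_mul,
    ← Complex.ofReal_div, Complex.ofReal_re] at h
  rw [← h, meanS, ← smul_eq_mul, ← Real.circleAverage_fun_smul]
  simp only [smul_eq_mul, mul_div_assoc]

theorem circleAverage_combination (hr0 : 0 ≤ r) (hr1 : r < 1) (k p q : ℕ) (x y c : ℝ)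
    {f : ℂ → ℝ} (hf : ∀ z : ℂ, ‖z‖ = 1 → f z * ‖scatterD r (z ^ 2) k‖ ^ 2 =
      x * ‖scatterS r (z ^ 2) p‖ ^ 2 + y * ‖scatterS r (z ^ 2) q‖ ^ 2 + c) :
    Real.circleAverage f 0 1 = x * meanS r k p + y * meanS r k q + c * meanInvD r k := by
  have hD : ∀ z ∈ sphere (0 : ℂ) 1, ‖scatterD r (z ^ 2) k‖ ^ 2 ≠ 0 := fun z hz =>
    pow_ne_zero 2 (norm_ne_zero_iff.2 (scatterD_ne_zero hr0 hr1
      (norm_pow_two_le_one (sphere_subset_closedBall hz)) k))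
  have hDc : ContinuousOn (fun z => ‖scatterD r (z ^ 2) k‖ ^ 2) (sphere (0 : ℂ) 1) :=
    ((((differentiable_scatterD r k).continuous.comp
      (continuous_pow 2)).norm).pow 2).continuousOn
  have hSc : ∀ q, ContinuousOn (fun z => ‖scatterS r (z ^ 2) q‖ ^ 2) (sphere (0 : ℂ) 1) :=
    fun q => ((((differentiable_scatterS r q).continuous.comp
      (continuous_pow 2)).norm).pow 2).continuousOn
  have h1 : ∀ (c : ℝ) (q : ℕ), CircleIntegrable (fun z =>
      c • (‖scatterS r (z ^ 2) q‖ ^ 2 / ‖scatterD r (z ^ 2) k‖ ^ 2)) 0 1 := fun c q =>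
    (((hSc q).div hDc hD).const_smul c).circleIntegrable zero_le_one
  have h2 : CircleIntegrable (fun z => c • (1 / ‖scatterD r (z ^ 2) k‖ ^ 2)) 0 1 :=
    ((continuousOn_const.div hDc hD).const_smul c).circleIntegrable zero_le_one
  have h12 : CircleIntegrable (fun z =>
      x • (‖scatterS r (z ^ 2) p‖ ^ 2 / ‖scatterD r (z ^ 2) k‖ ^ 2) +
        y • (‖scatterS r (z ^ 2) q‖ ^ 2 / ‖scatterD r (z ^ 2) k‖ ^ 2)) 0 1 :=
    (h1 x p).add (h1 y q)
  rw [meanS, meanS, meanInvD, ← smul_eq_mul x, ← smul_eq_mul y, ← smul_eq_mul c,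
    ← Real.circleAverage_fun_smul, ← Real.circleAverage_fun_smul, ← Real.circleAverage_fun_smul,
    ← Real.circleAverage_fun_add (h1 x p) (h1 y q),
    ← Real.circleAverage_fun_add h12 h2]
  refine Real.circleAverage_congr_sphere fun z hz => ?_
  rw [abs_one] at hz
  have h3 := hf z (mem_sphere_zero_iff_norm.1 hz)
  have h4 := hD z hz
  simp only [smul_eq_mul]
  rw [eq_div_of_mul_eq h4 h3]
  ring

/-- The average of the identity `|D_k|² = (1 - r)^k + r |S_k|²`, divided by `|D_k|²`. -/
theorem pow_mul_meanInvD (hr0 : 0 ≤ r) (hr1 : r < 1) (k : ℕ) :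
    (1 - r) ^ k * meanInvD r k = 1 - r * meanS r k k := by
  have h := circleAverage_combination hr0 hr1 k k k r 0 ((1 - r) ^ k) (f := fun _ => 1)
    fun z hz => by
      rw [← scatter_sq_sub_eq r (w := z ^ 2) (by rw [norm_pow, hz, one_pow]) k]
      ring
  rw [Real.circleAverage_const] at h
  linarith

theorem hasSum_mul_of_circleCoeff {f g : ℂ → ℂ} {x y : ℕ → ℝ}
    (hf : AnalyticOnNhd ℂ f (closedBall 0 1)) (hg : AnalyticOnNhd ℂ g (closedBall 0 1))
    (hx : ∀ t, circleCoeff f t = x t) (hy : ∀ t, circleCoeff g t = y t) :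
    HasSum (fun t => x t * y t) (Real.circleAverage (fun z => (f z * conj (g z)).re) 0 1) := by
  have hfc := hf.continuousOn.mono sphere_subset_closedBall
  have hgc := hg.continuousOn.mono sphere_subset_closedBall
  have h := (hasSum_circleCoeff_mul_conj hf hgc).mapL Complex.reCLM
  have hint : CircleIntegrable (fun z => f z * conj (g z)) 0 1 :=
    (hfc.mul (Complex.continuous_conj.comp_continuousOn hgc)).circleIntegrable zero_le_one
  rw [← Complex.reCLM.circleAverage_comp_comm hint] at h
  refine h.congr_fun fun t => ?_
  rw [hx, hy, Complex.conj_ofReal, ← Complex.ofReal_mul]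
  simp

theorem re_div_mul_conj_div (u x y d : ℂ) (hu : ‖u‖ = 1) (hd : d ≠ 0) :
    (u * x / d * conj (u * y / d)).re * ‖d‖ ^ 2 = (x * conj y).re := by
  have hu' : u * conj u = 1 := by
    rw [Complex.mul_conj', hu]
    simp
  have hcd : conj d ≠ 0 := by simpa using hd
  have h : u * x / d * conj (u * y / d) * ((‖d‖ ^ 2 : ℝ) : ℂ) = x * conj y := by
    push_cast
    rw [← Complex.mul_conj']
    simp only [map_div₀, map_mul]
    field_simp
    linear_combination x * conj y * hu'
  rw [← h, Complex.re_mul_ofReal]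

section sums
variable {k i j : ℕ}

theorem hasSum_sq_reducedAmplitude_fst (hr0 : 0 ≤ r) (hr1 : r < 1) (hk : k = i + (j + 1)) :
    HasSum (fun t => (reducedAmplitude r k t i).1 * (reducedAmplitude r k t i).1)
      (meanS r k (j + 1)) := by
  have hi : i < k := by omega
  have h := hasSum_mul_of_circleCoeff (analyticOnNhd_genR hr0 hr1 k i)
    (analyticOnNhd_genR hr0 hr1 k i) (fun t => (circleCoeff_gen hr0 hr1 t i hi).1)
    (fun t => (circleCoeff_gen hr0 hr1 t i hi).1)
  rw [circleAverage_combination hr0 hr1 k (j + 1) (j + 1) 1 0 0] at h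
  · simpa using h
  · intro z hz
    have hw : ‖z ^ 2‖ = 1 := by rw [norm_pow, hz, one_pow]
    rw [genR, re_div_mul_conj_div _ _ _ _ (by rw [norm_pow, hz, one_pow])
      (scatterD_ne_zero hr0 hr1 hw.le k), show k - i = j + 1 by omega, Complex.mul_conj']
    rw [← Complex.ofReal_pow, Complex.ofReal_re]
    ring

theorem hasSum_sq_reducedAmplitude_snd (hr0 : 0 ≤ r) (hr1 : r < 1) (hk : k = i + (j + 1)) :
    HasSum (fun t => (reducedAmplitude r k t i).2 * (reducedAmplitude r k t i).2)
      (r * meanS r k j + (1 - r) ^ j * meanInvD r k) := by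
  have hi : i < k := by omega
  have h := hasSum_mul_of_circleCoeff (analyticOnNhd_genL hr0 hr1 k i)
    (analyticOnNhd_genL hr0 hr1 k i) (fun t => (circleCoeff_gen hr0 hr1 t i hi).2)
    (fun t => (circleCoeff_gen hr0 hr1 t i hi).2)
  rw [circleAverage_combination hr0 hr1 k j j r 0 ((1 - r) ^ j)] at h
  · simpa using h
  · intro z hz
    have hw : ‖z ^ 2‖ = 1 := by rw [norm_pow, hz, one_pow]
    rw [genL, re_div_mul_conj_div _ _ _ _ (by rw [norm_pow, hz, one_pow])
      (scatterD_ne_zero hr0 hr1 hw.le k), show k - 1 - i = j by omega, Complex.mul_conj',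
      ← Complex.ofReal_pow, Complex.ofReal_re, ← scatter_sq_sub_eq r hw j]
    ring

theorem hasSum_mul_reducedAmplitude (hr0 : 0 ≤ r) (hr1 : r < 1) (hk : k = i + (j + 1)) :
    HasSum (fun t => (reducedAmplitude r k t i).1 * (reducedAmplitude r k t i).2)
      (1 / 2 * meanS r k (j + 1) + (r - 1) / 2 * meanS r k j +
        (1 - r) ^ j / 2 * meanInvD r k) := by
  have hi : i < k := by omega
  have h := hasSum_mul_of_circleCoeff (analyticOnNhd_genR hr0 hr1 k i)
    (analyticOnNhd_genL hr0 hr1 k i) (fun t => (circleCoeff_gen hr0 hr1 t i hi).1)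
    (fun t => (circleCoeff_gen hr0 hr1 t i hi).2)
  rwa [circleAverage_combination hr0 hr1 k (j + 1) j (1 / 2) ((r - 1) / 2) ((1 - r) ^ j / 2)] at h
  intro z hz
  have hw : ‖z ^ 2‖ = 1 := by rw [norm_pow, hz, one_pow]
  rw [genR, genL, re_div_mul_conj_div _ _ _ _ (by rw [norm_pow, hz, one_pow])
    (scatterD_ne_zero hr0 hr1 hw.le k), show k - i = j + 1 by omega,
    show k - 1 - i = j by omega, ← scatter_sq_sub_eq r hw j, scatterS_succ]
  have hS : ‖z ^ 2 * scatterS r (z ^ 2) j‖ ^ 2 = ‖scatterS r (z ^ 2) j‖ ^ 2 := by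
    rw [norm_mul, hw, one_mul]
  rw [← hS]
  generalize z ^ 2 * scatterS r (z ^ 2) j = x
  generalize scatterD r (z ^ 2) j = y
  simp only [Complex.sq_norm, Complex.normSq_apply, Complex.add_re, Complex.add_im,
    Complex.mul_re, Complex.conj_re, Complex.conj_im]
  ring

end sums

theorem edgePair_nonneg_pos (hr0 : 0 ≤ r) (j : ℕ) :
    0 ≤ (edgePair r j).1 ∧ 0 < (edgePair r j).2 := by
  induction j with
  | zero => simp [edgePair]
  | succ j ih =>
    obtain ⟨h1, h2⟩ := ih
    simp only [edgePair]
    constructor <;> positivity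

/-- The sum of `hasSum_sq_reducedAmplitude_snd`, weighted as in `leftTerm_zero_one`, in terms of the
values at the edge `w = 1`. -/
theorem pow_mul_sum_sq_snd (hr0 : 0 ≤ r) (hr1 : r < 1) {i j k : ℕ} (hk : k = i + (j + 1)) :
    (1 - r) ^ (i + 1) * (r * meanS r k j + (1 - r) ^ j * meanInvD r k) =
      (r * ((edgePair r j).1 * (edgePair r (i + 1)).1) +
        (1 - r) * ((edgePair r j).2 * (edgePair r i).2)) / (edgePair r k).2 := by
  have h1 := pow_mul_meanS hr0 hr1 (i + 1) j
  have h2 := pow_mul_meanInvD hr0 hr1 k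
  have h3 := pow_mul_meanS hr0 hr1 0 k
  have hpos := (edgePair_nonneg_pos hr0 k).2.ne'
  have ha := edgePair_add r (i + 1) j
  rw [show i + 1 + j = k by omega] at h1 ha
  rw [pow_zero, one_mul, zero_add] at h3
  have h4 : (1 - r) ^ (i + 1) * (r * meanS r k j + (1 - r) ^ j * meanInvD r k) =
      r * ((1 - r) ^ (i + 1) * meanS r k j) + (1 - r) ^ k * meanInvD r k := by
    rw [show k = i + 1 + j by omega, pow_add _ _ j]
    ring
  rw [h4, h1, h2, h3]
  field_simp
  rw [ha.1, ha.2]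
  simp only [edgePair]
  ring

/-- The sum of `hasSum_mul_reducedAmplitude`, weighted as in `crossSummand_eq`, in terms of the
values at the edge `w = 1`. -/
theorem pow_mul_sum_mul (hr0 : 0 ≤ r) (hr1 : r < 1) {i j k : ℕ} (hk : k = i + (j + 1)) :
    (1 - r) ^ i * (1 / 2 * meanS r k (j + 1) + (r - 1) / 2 * meanS r k j +
        (1 - r) ^ j / 2 * meanInvD r k) =
      (edgePair r j).2 * (edgePair r i).2 / (edgePair r k).2 := by
  have h0 := pow_mul_meanS hr0 hr1 i (j + 1)
  have h1 := pow_mul_meanS hr0 hr1 (i + 1) j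
  have h2 := pow_mul_meanInvD hr0 hr1 k
  have h3 := pow_mul_meanS hr0 hr1 0 k
  have hpos := (edgePair_nonneg_pos hr0 k).2.ne'
  have ha := edgePair_add r (i + 1) j
  have hr : 1 - r ≠ 0 := by linarith
  rw [← hk] at h0
  rw [show i + 1 + j = k by omega] at h1 ha
  rw [pow_zero, one_mul, zero_add] at h3
  apply mul_left_cancel₀ hr
  have h4 : (1 - r) * ((1 - r) ^ i * (1 / 2 * meanS r k (j + 1) + (r - 1) / 2 * meanS r k j +
        (1 - r) ^ j / 2 * meanInvD r k)) =
      (1 - r) / 2 * ((1 - r) ^ i * meanS r k (j + 1)) -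
      (1 - r) / 2 * ((1 - r) ^ (i + 1) * meanS r k j) + 1 / 2 * ((1 - r) ^ k * meanInvD r k) := by
    rw [show k = i + 1 + j by omega, pow_add _ _ j]
    ring
  rw [h4, h0, h1, h2, h3]
  field_simp
  rw [ha.1, ha.2]
  simp only [edgePair]
  ring

/-! ### The absorption series -/

theorem norm_sq_add_norm_sq_of_mem_unitaryGroup {a b : ℂ}
    (hU : coinMatrix a b ∈ Matrix.unitaryGroup (Fin 2) ℂ) : ‖a‖ ^ 2 + ‖b‖ ^ 2 = 1 := by
  have h := congrFun (congrFun (Matrix.mem_unitaryGroup_iff.1 hU) 0) 0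
  simp only [coinMatrix, Matrix.mul_apply, Fin.sum_univ_two, Matrix.star_apply, Matrix.of_apply,
    Matrix.cons_val_zero, Matrix.cons_val_one, Matrix.one_apply_eq, RCLike.star_def,
    Complex.mul_conj'] at h
  exact_mod_cast h

theorem hitAmplitude_initialState (a b : ℂ) (B : Set (ℤ × C₁)) (m : ℕ) (α β : ℂ) (x : ℤ × C₁)
    (t : ℕ) :
    hitAmplitude (coin a b) B (initialState m α β) x t =
      α * hitAmplitude (coin a b) B (ket ((m : ℤ), dirR)) x t +
        β * hitAmplitude (coin a b) B (ket ((m : ℤ), dirL)) x t :=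
  hitAmplitude_add_smul _ _ _ _ _ _ _ _

variable {a b : ℂ} {k i : ℕ}

theorem leftTerm_eq (a b : ℂ) (hi : i < k) (α β : ℂ) (t : ℕ) :
    leftTerm a b (k + 1) (i + 1) α β t =
      ‖α * hitAmplitude (coin a b) (boundary (k + 1)) (ket ((i : ℤ) + 1, dirR)) (0, dirL) t +
        β * hitAmplitude (coin a b) (boundary (k + 1)) (ket ((i : ℤ) + 1, dirL)) (0, dirL) t‖
          ^ 2 := by
  have hne : ((0 : ℤ), dirR) ≠ (0, dirL) := by decide
  rw [leftTerm, absorptionTerm, leftBoundary, Finset.sum_pair hne, hitAmplitude_initialState,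
    hitAmplitude_initialState, Nat.cast_succ, hitAmplitude_dirR_eq_zero a b k t i hi,
    hitAmplitude_dirR_eq_zero a b k t i hi]
  simp

theorem leftTerm_one_zero (hab : ‖a‖ ^ 2 + ‖b‖ ^ 2 = 1) (hi : i < k) (t : ℕ) :
    leftTerm a b (k + 1) (i + 1) 1 0 t = ‖b‖ ^ 2 * (1 - ‖b‖ ^ 2) ^ i *
      ((reducedAmplitude (‖b‖ ^ 2) k t i).1 * (reducedAmplitude (‖b‖ ^ 2) k t i).1) := by
  rw [leftTerm_eq a b hi, (hitAmplitude_dirL_eq hab k t i hi).1, ← hab, add_sub_cancel_right]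
  simp only [one_mul, zero_mul, add_zero, norm_mul, norm_neg, norm_pow, RCLike.norm_conj,
    Complex.norm_real, mul_pow, Real.norm_eq_abs, sq_abs]
  ring

theorem leftTerm_zero_one (hab : ‖a‖ ^ 2 + ‖b‖ ^ 2 = 1) (hi : i < k) (t : ℕ) :
    leftTerm a b (k + 1) (i + 1) 0 1 t = (1 - ‖b‖ ^ 2) ^ (i + 1) *
      ((reducedAmplitude (‖b‖ ^ 2) k t i).2 * (reducedAmplitude (‖b‖ ^ 2) k t i).2) := by
  rw [leftTerm_eq a b hi, (hitAmplitude_dirL_eq hab k t i hi).2, ← hab, add_sub_cancel_right]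
  simp only [one_mul, zero_mul, zero_add, norm_mul, norm_pow, RCLike.norm_conj,
    Complex.norm_real, mul_pow, Real.norm_eq_abs, sq_abs]
  ring

theorem crossSummand_eq (hab : ‖a‖ ^ 2 + ‖b‖ ^ 2 = 1) (hi : i < k) (t : ℕ) :
    crossSummand a b (k + 1) (i + 1) t = -(a * conj b) * (((1 - ‖b‖ ^ 2) ^ i *
      ((reducedAmplitude (‖b‖ ^ 2) k t i).1 * (reducedAmplitude (‖b‖ ^ 2) k t i).2) : ℝ) : ℂ) := by
  rw [crossSummand, Nat.cast_succ, (hitAmplitude_dirL_eq hab k t i hi).1,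
    (hitAmplitude_dirL_eq hab k t i hi).2, ← hab, add_sub_cancel_right]
  push_cast
  rw [← Complex.mul_conj' a]
  simp only [map_mul, map_pow, Complex.conj_conj, Complex.conj_ofReal]
  ring

theorem seqR_eq (b : ℂ) (j : ℕ) : seqR b j = 2 * (‖b‖ * (edgePair (‖b‖ ^ 2) j).1) :=
  (edgePair_of_sq ‖b‖ j).1.symm

theorem seqB_eq (b : ℂ) (j : ℕ) : seqB b j = 2 * (edgePair (‖b‖ ^ 2) j).2 :=
  (edgePair_of_sq ‖b‖ j).2.symm

end QuantumWalk

theorem theorem4p2 (a b : ℂ) (hU : coinMatrix a b ∈ Matrix.unitaryGroup (Fin 2) ℂ) (ha : a ≠ 0)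
    (n m : ℕ) (hm : 1 ≤ m) (hmn : m < n) :
    (Summable (leftTerm a b n m 1 0) ∧
      leftProb a b n m 1 0 = ‖b‖ / 2 * (seqR b (n - m) * seqB b (m - 1) / seqB b (n - 1))) ∧
    (Summable (leftTerm a b n m 0 1) ∧
      leftProb a b n m 0 1 =
        1 / 2 * (seqR b (n - m - 1) * seqR b m / seqB b (n - 1) +
          ‖a‖ ^ 2 * (seqB b (n - m - 1) * seqB b (m - 1) / seqB b (n - 1)))) ∧
    (Summable (crossSummand a b n m) ∧
      crossTerm a b n m =
        -(a * (starRingEnd ℂ) b) / 2 *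
          ((seqB b (n - m - 1) * seqB b (m - 1) / seqB b (n - 1) : ℝ) : ℂ)) := by
  obtain ⟨i, rfl⟩ : ∃ i, m = i + 1 := ⟨m - 1, by omega⟩
  obtain ⟨j, rfl⟩ : ∃ j, n = i + (j + 1) + 1 := ⟨n - i - 2, by omega⟩
  have hab := norm_sq_add_norm_sq_of_mem_unitaryGroup hU
  have hr0 : 0 ≤ ‖b‖ ^ 2 := by positivity
  have hr1 : ‖b‖ ^ 2 < 1 := by
    have : 0 < ‖a‖ ^ 2 := by positivity
    linarith
  have hi : i < i + (j + 1) := by omega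
  have hpos := (edgePair_nonneg_pos hr0 (i + (j + 1))).2.ne'
  have e1 : i + (j + 1) + 1 - (i + 1) = j + 1 := by omega
  have e2 : i + (j + 1) + 1 - (i + 1) - 1 = j := by omega
  simp only [e1, Nat.add_sub_cancel, seqB_eq, seqR_eq]
  have hR := ((hasSum_sq_reducedAmplitude_fst hr0 hr1 (rfl : i + (j + 1) = _)).mul_left
    (‖b‖ ^ 2 * (1 - ‖b‖ ^ 2) ^ i)).congr_fun fun t => leftTerm_one_zero hab hi t
  have hL := ((hasSum_sq_reducedAmplitude_snd hr0 hr1 (rfl : i + (j + 1) = _)).mul_left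
    ((1 - ‖b‖ ^ 2) ^ (i + 1))).congr_fun fun t => leftTerm_zero_one hab hi t
  have hC := ((Complex.hasSum_ofReal.2 ((hasSum_mul_reducedAmplitude hr0 hr1
    (rfl : i + (j + 1) = _)).mul_left ((1 - ‖b‖ ^ 2) ^ i))).mul_left
      (-(a * (starRingEnd ℂ) b))).congr_fun fun t => crossSummand_eq hab hi t
  rw [mul_assoc, pow_mul_meanS hr0 hr1 i (j + 1)] at hR
  rw [pow_mul_sum_sq_snd hr0 hr1 rfl] at hL
  rw [pow_mul_sum_mul hr0 hr1 rfl] at hC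
  refine ⟨⟨hR.summable, ?_⟩, ⟨hL.summable, ?_⟩, ⟨hC.summable, ?_⟩⟩
  · rw [leftProb, hR.tsum_eq]
    field_simp
  · rw [leftProb, hL.tsum_eq, eq_sub_of_add_eq hab]
    field_simp
  · rw [crossTerm, hC.tsum_eq]
    have h : ∀ x y d : ℝ, 2 * x * (2 * y) / (2 * d) = 2 * (x * y / d) := fun x y d => by
      rw [mul_mul_mul_comm, mul_assoc 2 2, mul_div_mul_left _ _ (two_ne_zero), mul_div_assoc]
    rw [h, Complex.ofReal_mul, Complex.ofReal_ofNat]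
    ring
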